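/- **Theorem (spatial versus spectral entropy).** Let $(X,\mu)$ be a $\sigma$-finite measure space, $V$ a separable complex Hilbert space, and $\mathcal H=L^2(X,\mu;V)$. Let $A$ be a (possibly unbounded) self-adjoint operator on $\mathcal H$, and let $\rho$ be a state, i.e. a positive trace class operator on $\mathcal H$, with trace $\tau(\rho)$ and operator norm $\|\rho\|_\infty$. For a bounded positive operator $P$ on $\mathcal H$, let $\nu_P$ be the measure $\nu_P(\Omega)=\tau(P^{1/2}\chi_\Omega P^{1/2})$ on $X$, and let $D\nu_P=d\nu_P/d\mu: X\to[0,\infty]$ be its density function. Let $\Pi_\lambda=1_{(-\infty,\lambda)}(A)$ be the spectral projections of $A$, and put $$F_A(\lambda)=\operatorname*{ess\,sup}_{x\in X} D\nu_{\Pi_\lambda}(x)\in[0,\infty],\qquad F_A^+(\lambda)=\lim_{\varepsilon\to0^+}F_A(\lambda+\varepsilon).$$ Write $d\tau(\rho\,\Pi_\lambda)$ for the measure $S\mapsto\tau(\rho^{1/2}1_S(A)\rho^{1/2})$ on $\mathbb R$ and, with $\ln 0=-\infty$ and $\ln\infty=\infty$, $$\mathcal E^+_{\ln F_A^+(A)}(\rho)=\int_{\mathbb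 R}\max(\ln F_A^+(\lambda),0)\,d\tau(\rho\,\Pi_\lambda),\qquad S_\lambda(\rho)=\mathcal E_{\ln F_A^+(A)}(\rho)=\tau(\ln F_A^+(A)\,\rho)=\int_{\mathbb R}\ln F_A^+(\lambda)\,d\tau(\rho\,\Pi_\lambda).$$ Assume that $\mathcal E^+_{\ln F_A^+(A)}(\rho)$ is finite, so that $S_\lambda(\rho)\in[-\infty,\infty)$. Then the integral in $$S_\mu(\rho)=-\int_X\ln\Bigl(\frac{D\nu_\rho(x)}{\|\rho\|_\infty}\Bigr)\,d\nu_\rho(x)+3\,\tau(\rho)$$ has a finite negative part, so that $S_\mu(\rho)\in(-\infty,\infty]$ (for $\rho=0$, where $\nu_\rho=0$, the integral is $0$), and $$S_\lambda(\rho)+S_\mu(\rho)\ge 0,$$ which, when $S_\lambda(\rho)=-\infty$, is understood as $S_\mu(\rho)=+\infty$. -/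

import Mathlib

open MeasureTheory
open scoped ENNReal InnerProductSpace ComplexOrder

noncomputable section

namespace EntropyBound

section Hilbert

variable {H : Type*} [NormedAddCommGroup H] [InnerProductSpace ℂ H] [CompleteSpace H]

/-! ### Traces and states -/

variable (H) in
/-- Index set of a fixed Hilbert basis of `H`. -/
def basisIndex : Set H := (exists_hilbertBasis ℂ H).choose

variable (H) in
/-- A fixed Hilbert basis `(e_i)` of `H`; the traces below do not depend on it. -/
def basis : HilbertBasis (basisIndex H) ℂ H := (exists_hilbertBasis ℂ H).choose_spec.choose

/-- The trace `τ(T) = ∑ᵢ ⟪eᵢ, T eᵢ⟫ ∈ [0, ∞]` of a positive bounded operator `T`. -/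
def trace (T : H →L[ℂ] H) : ℝ≥0∞ :=
  ∑' i, ENNReal.ofReal (RCLike.re ⟪basis H i, T (basis H i)⟫_ℂ)

/-- A (mixed) state: a positive trace class operator. -/
structure IsState (ρ : H →L[ℂ] H) : Prop where
  isPositive : ρ.IsPositive
  trace_ne_top : trace ρ ≠ ∞

/-- The vectors `P^{1/2} eᵢ`, for a bounded positive operator `P`. -/
def sqrtBasis (P : H →L[ℂ] H) (i : basisIndex H) : H := CFC.sqrt P (basis H i)

/-! ### Spectral projections of an unbounded self-adjoint operator -/

/-- `R` is the resolvent `(A + i)⁻¹`: an everywhere defined bounded two-sided inverse of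
`A + i : A.domain → H`. -/
def IsResolvent (A : H →ₗ.[ℂ] H) (R : H →L[ℂ] H) : Prop :=
  (∀ x : A.domain, R (A x + Complex.I • (x : H)) = x) ∧
    ∀ y : H, ∃ x : A.domain, (x : H) = R y ∧ A x + Complex.I • (x : H) = y

theorem norm_sq_add_I {A : H →ₗ.[ℂ] H} (hA : IsSelfAdjoint A) (x : A.domain) :
    ‖A x + Complex.I • (x : H)‖ ^ 2 = ‖A x‖ ^ 2 + ‖(x : H)‖ ^ 2 := by
  have hfa : A.IsFormalAdjoint A := by
    have h := LinearPMap.adjoint_isFormalAdjoint (T := A) hA.dense_domain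
    rwa [LinearPMap.isSelfAdjoint_def.mp hA] at h
  have h1 : ⟪A x, (x : H)⟫_ℂ = ⟪(x : H), A x⟫_ℂ := hfa x x
  have h2 : (⟪A x, (x : H)⟫_ℂ).im = 0 := by
    rw [← Complex.conj_eq_iff_im, inner_conj_symm, h1]
  rw [@norm_add_sq ℂ, inner_smul_right, norm_smul]
  simp [h2]

/-- A self-adjoint operator has a resolvent at `-i`. -/
theorem exists_isResolvent {A : H →ₗ.[ℂ] H} (hA : IsSelfAdjoint A) :
    ∃ R : H →L[ℂ] H, IsResolvent A R := by
  have hcl : IsClosed (A.graph : Set (H × H)) := hA.isClosed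
  have : CompleteSpace A.graph := hcl.completeSpace_coe
  let φ : A.graph →L[ℂ] H :=
    (ContinuousLinearMap.snd ℂ H H + Complex.I • ContinuousLinearMap.fst ℂ H H).comp
      A.graph.subtypeL
  have hφ : ∀ x : A.domain, ∀ h, φ ⟨((x : H), A x), h⟩ = A x + Complex.I • (x : H) :=
    fun x h => rfl
  have hanti : AntilipschitzWith 1 φ := by
    refine AddMonoidHomClass.antilipschitz_of_bound φ ?_
    rintro ⟨⟨a, b⟩, h⟩
    obtain ⟨x, rfl, rfl⟩ := A.mem_graph_iff.mp h
    rw [hφ]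
    have := norm_sq_add_I hA x
    simp only [NNReal.coe_one, one_mul]
    change max ‖(x : H)‖ ‖A x‖ ≤ _
    refine max_le ?_ ?_ <;> refine abs_le_of_sq_le_sq' ?_ (norm_nonneg _) |>.2 <;>
      nlinarith [sq_nonneg ‖A x‖, sq_nonneg ‖(x : H)‖]
  have hclr : IsClosed (φ.range : Set H) := by
    have := hanti.isClosed_range φ.uniformContinuous
    exact this
  have hrange : φ.range = ⊤ := by
    have : CompleteSpace φ.range := hclr.completeSpace_coe
    rw [← Submodule.orthogonal_eq_bot_iff, Submodule.eq_bot_iff]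
    intro w hw
    have hw' : ∀ x : A.domain, ⟪w, A x + Complex.I • (x : H)⟫_ℂ = 0 := by
      intro x
      refine (Submodule.mem_orthogonal' _ _).mp hw _ ?_
      exact ⟨⟨((x : H), A x), A.mem_graph x⟩, rfl⟩
    have hw2 : ∀ x : A.domain, ⟪Complex.I • w, (x : H)⟫_ℂ = ⟪w, A x⟫_ℂ := by
      intro x
      have := hw' x
      rw [inner_add_right, inner_smul_right] at this
      rw [inner_smul_left, Complex.conj_I]
      linear_combination -this
    have hmem : w ∈ A.adjoint.domain := LinearPMap.mem_adjoint_domain_of_exists _ ⟨_, hw2⟩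
    rw [LinearPMap.isSelfAdjoint_def.mp hA] at hmem
    have hAd := LinearPMap.adjoint_apply_eq (T := A) hA.dense_domain
      (y := ⟨w, by rw [LinearPMap.isSelfAdjoint_def.mp hA]; exact hmem⟩) hw2
    have hfa := LinearPMap.adjoint_isFormalAdjoint (T := A) hA.dense_domain
    have hAw : A ⟨w, hmem⟩ = Complex.I • w := by
      rw [← hAd]
      have hle : A ≤ A.adjoint := (LinearPMap.isSelfAdjoint_def.mp hA).ge
      exact hle.2 rfl
    have h3 := norm_sq_add_I hA ⟨w, hmem⟩
    have h4 := hw' ⟨w, hmem⟩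
    rw [hAw] at h4
    simp only [inner_add_right, inner_smul_right] at h4
    have h5 : ⟪w, w⟫_ℂ = 0 := by
      have : (2 * Complex.I) * ⟪w, w⟫_ℂ = 0 := by linear_combination h4
      simpa using this
    exact inner_self_eq_zero.mp h5
  have hker : φ.ker = ⊥ := LinearMap.ker_eq_bot.mpr hanti.injective
  let e := ContinuousLinearEquiv.ofBijective φ hker hrange
  have he : ∀ g, e g = φ g := fun g => rfl
  refine ⟨(ContinuousLinearMap.fst ℂ H H).comp (A.graph.subtypeL.comp (e.symm : H →L[ℂ] A.graph)),
    ?_, ?_⟩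
  · intro x
    have : e.symm (A x + Complex.I • (x : H)) = ⟨((x : H), A x), A.mem_graph x⟩ := by
      rw [ContinuousLinearEquiv.symm_apply_eq]; rfl
    simp [this]
  · intro y
    obtain ⟨x, hx1, hx2⟩ := A.mem_graph_iff.mp (e.symm y).2
    refine ⟨x, hx1, ?_⟩
    have : φ (e.symm y) = y := by rw [← he]; simp
    rw [hx1, hx2]
    exact this

open Classical in
/-- The resolvent `(A + i)⁻¹`; it exists for every self-adjoint `A`, by `exists_isResolvent`, and
is clearly unique. -/
def resolvent (A : H →ₗ.[ℂ] H) : H →L[ℂ] H :=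
  if h : ∃ R : H →L[ℂ] H, IsResolvent A R then h.choose else 0

/-- The bounded positive operator `g(A)`, where `g(s) = max(l - s, 0) / (1 + s²)`. It is computed
by the continuous functional calculus of the normal operator `R = (A + i)⁻¹`: for
`z = (s + i)⁻¹` one has `‖z‖² = 1 / (1 + s²)` and `re z = s / (1 + s²)`, so that
`max(l - s, 0) / (1 + s²) = max(l ‖z‖² - re z, 0)`. -/
def cutoff (A : H →ₗ.[ℂ] H) (l : ℝ) : H →L[ℂ] H :=
  cfc (fun z : ℂ => ((max (l * ‖z‖ ^ 2 - z.re) 0 : ℝ) : ℂ)) (resolvent A)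

/-- The spectral projection `Π_l = 1_{(-∞, l)}(A)`. As `g(s) = max(l - s, 0) / (1 + s²)` is
nonnegative and `g(s) > 0 ↔ s < l`, it is the support projection `1_{(0, ∞)}(g(A))` of `g(A)`,
that is the orthogonal projection onto `(ker g(A))ᗮ`, which is the closure of the range
of `g(A)`. -/
def spectralProjection (A : H →ₗ.[ℂ] H) (l : ℝ) : H →L[ℂ] H :=
  ((cutoff A l).kerᗮ).starProjection

theorem cutoff_nonneg (A : H →ₗ.[ℂ] H) (l : ℝ) : 0 ≤ cutoff A l :=
  cfc_nonneg fun z _ => by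
    rw [Complex.zero_le_real]; exact le_max_right _ _

theorem cutoff_mono (A : H →ₗ.[ℂ] H) : Monotone (cutoff A) := by
  intro l m hlm
  refine cfc_mono (fun z _ => ?_) ?_ ?_
  · rw [Complex.real_le_real]
    gcongr
  · exact Continuous.continuousOn (by fun_prop)
  · exact Continuous.continuousOn (by fun_prop)

/-- `l ↦ ‖Π_l f‖²` is nondecreasing. -/
theorem norm_spectralProjection_mono (A : H →ₗ.[ℂ] H) (f : H) :
    Monotone fun l => ‖spectralProjection A l f‖ ^ 2 := by
  intro l m hlm
  have hker : (cutoff A m).ker ≤ (cutoff A l).ker := by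
    intro x hx
    have h1 : ((cutoff A l : H →L[ℂ] H)).IsPositive :=
      (ContinuousLinearMap.nonneg_iff_isPositive _).mp (cutoff_nonneg A l)
    have h2 : (cutoff A m - cutoff A l).IsPositive :=
      (ContinuousLinearMap.le_def _ _).mp (cutoff_mono A hlm)
    have hx0 : cutoff A m x = 0 := hx
    have h3 := h2.re_inner_nonneg_left x
    have h4 := h1.re_inner_nonneg_left x
    have h5 : RCLike.re ⟪cutoff A l x, x⟫_ℂ = 0 := by
      refine le_antisymm ?_ h4
      simpa [hx0] using h3
    obtain ⟨S, hS⟩ := (CStarAlgebra.nonneg_iff_eq_star_mul_self).mp (cutoff_nonneg A l)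
    have h6 : S x = 0 := by
      rw [hS] at h5
      have : ⟪(star S * S) x, x⟫_ℂ = ⟪S x, S x⟫_ℂ := by
        rw [mul_apply_eq_comp, ContinuousLinearMap.star_eq_adjoint,
          ContinuousLinearMap.adjoint_inner_left]
      rw [this, inner_self_eq_norm_sq] at h5
      simpa using h5
    change cutoff A l x = 0
    rw [hS, mul_apply_eq_comp, h6, map_zero]
  have hle : (cutoff A l).kerᗮ ≤ (cutoff A m).kerᗮ := Submodule.orthogonal_le hker
  have h7 : spectralProjection A l f = spectralProjection A l (spectralProjection A m f) := by
    unfold spectralProjection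
    rw [← ContinuousLinearMap.comp_apply, Submodule.starProjection_comp_starProjection_of_le hle]
  simp only
  rw [h7]
  gcongr
  exact Submodule.norm_starProjection_apply_le _ _

/-- The spectral measure of `A` at the vector `f`: the Lebesgue-Stieltjes measure `d‖Π_l f‖²`
on `ℝ`, so that `⟪f, φ(A) f⟫ = ∫ φ d(vectorSpectralMeasure A f)`. -/
def vectorSpectralMeasure (A : H →ₗ.[ℂ] H) (f : H) : Measure ℝ :=
  (norm_spectralProjection_mono A f).stieltjesFunction.measure

/-- The energy distribution of the positive operator `ρ`: the measure
`S ↦ τ(ρ^{1/2} 1_S(A) ρ^{1/2})` on `ℝ`, i.e. the measure `dτ(ρ Π_l)`. -/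
def energyDistribution (A : H →ₗ.[ℂ] H) (ρ : H →L[ℂ] H) : Measure ℝ :=
  Measure.sum fun i => vectorSpectralMeasure A (sqrtBasis ρ i)

end Hilbert

/-- The extended-real integral `∫ f⁺ dm - ∫ f⁻ dm` (used when one of the two parts is finite). -/
def extIntegral {Y : Type*} [MeasurableSpace Y] (m : Measure Y) (f : Y → EReal) : EReal :=
  ((∫⁻ y, (f y).toENNReal ∂m : ℝ≥0∞) : EReal) - ((∫⁻ y, (-f y).toENNReal ∂m : ℝ≥0∞) : EReal)

section Energy

variable {H : Type*} [NormedAddCommGroup H] [InnerProductSpace ℂ H] [CompleteSpace H]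

/-- `ℰ⁺_{φ(A)}(ρ) = τ(ρ^{1/2} max(φ(A), 0) ρ^{1/2})`, for an extended-real valued function `φ`
of the energy. -/
def posEnergy (φ : ℝ → EReal) (A : H →ₗ.[ℂ] H) (ρ : H →L[ℂ] H) : ℝ≥0∞ :=
  ∫⁻ l, (φ l).toENNReal ∂(energyDistribution A ρ)

/-- `ℰ_{φ(A)}(ρ) = τ(φ(A) ρ) = ∫ φ(l) dτ(ρ Π_l)`, when its positive part is finite. -/
def energy (φ : ℝ → EReal) (A : H →ₗ.[ℂ] H) (ρ : H →L[ℂ] H) : EReal :=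
  extIntegral (energyDistribution A ρ) φ

end Energy

section Density

variable {X : Type*} [MeasurableSpace X] {μ : Measure X}
  {V : Type*} [NormedAddCommGroup V] [InnerProductSpace ℂ V] [CompleteSpace V]

/-- The measure `ν_P(Ω) = τ(P^{1/2} χ_Ω P^{1/2}) = ∑ᵢ ∫_Ω ‖(P^{1/2} eᵢ)(x)‖² dμ(x)` of a bounded
positive operator `P` on `L²(X, V)`. -/
def densityMeasure (P : Lp V 2 μ →L[ℂ] Lp V 2 μ) : Measure X :=
  Measure.sum fun i => μ.withDensity fun x => ‖sqrtBasis P i x‖ₑ ^ 2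

/-- The density function `Dν_P = dν_P / dμ`, with values in `[0, ∞]`. -/
def density (P : Lp V 2 μ →L[ℂ] Lp V 2 μ) : X → ℝ≥0∞ :=
  (densityMeasure P).rnDeriv μ

/-- `F_A(l) = ess sup_x F_{A,x}(l)`, where `F_{A,x}(l) = Dν_{Π_l}(x)` is the spectral density
function of `A`. -/
def spectralDensity (A : Lp V 2 μ →ₗ.[ℂ] Lp V 2 μ) (l : ℝ) : ℝ≥0∞ :=
  essSup (density (spectralProjection A l)) μ

/-- `ln F_A⁺ : ℝ → [-∞, ∞]`, where `F_A⁺` is the right limit of `F_A`. -/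
def logSpectralDensity (A : Lp V 2 μ →ₗ.[ℂ] Lp V 2 μ) (l : ℝ) : EReal :=
  ENNReal.log (Function.rightLim (spectralDensity A) l)

/-- The spectral entropy `S_λ(ρ) = ℰ_{ln F_A⁺(A)}(ρ) = τ(ln F_A⁺(A) ρ)`. -/
def spectralEntropy (A : Lp V 2 μ →ₗ.[ℂ] Lp V 2 μ) (ρ : Lp V 2 μ →L[ℂ] Lp V 2 μ) : EReal :=
  energy (logSpectralDensity A) A ρ

/-- The integrand `-ln(Dν_ρ(x) / ‖ρ‖_∞)` of the spatial entropy. -/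
def entropyIntegrand (ρ : Lp V 2 μ →L[ℂ] Lp V 2 μ) (x : X) : EReal :=
  -ENNReal.log (density ρ x / ‖ρ‖ₑ)

/-- The spatial entropy `S_μ(ρ) = -∫ ln(Dν_ρ / ‖ρ‖_∞) dν_ρ + 3 τ(ρ)`. -/
def spatialEntropy (ρ : Lp V 2 μ →L[ℂ] Lp V 2 μ) : EReal :=
  extIntegral (densityMeasure ρ) (entropyIntegrand ρ) + 3 * (trace ρ : EReal)

end Density

end EntropyBound

end

noncomputable section

namespace EntropyBound

section InnerProductSpace

variable {H : Type*} [NormedAddCommGroup H] [InnerProductSpace ℂ H]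

/-! Fix `l` and split each vector `ρ^{1/2} eᵢ` into its image under `Π_l` and the remainder. The
images have total density at most `‖ρ‖ F_A(l)` almost everywhere: over a set `E` this compares the
Hilbert-Schmidt norms of `χ_E Π_l ρ^{1/2}` and `χ_E Π_l`. The remainders have total mass at most
`m[l, ∞)`, where `m` is the energy distribution. Minkowski's inequality in `ℓ²`, applied at each
point, gives `∫ (Dν_ρ^{1/2} - (‖ρ‖ c)^{1/2})₊² dμ ≤ m[l, ∞)` whenever `F_A(l) ≤ c`, and a limit in
`l` turns the right side into `m{F_A⁺ ≥ c}` (`lintegral_sq_sub_le`).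

Now put `c = e^s` and integrate over `s > -M`. The right side becomes `∫ (ln F_A⁺ + M)₊ dm` by
Tonelli; the left side is computed pointwise and is at least `∫ (ln(Dν_ρ/‖ρ‖) + M - 3)₊ dν_ρ`, which
is the origin of the constant 3 (`lintegral_log_density_le`). Since `ν_ρ` and `m` both have total
mass `τ(ρ)`, the shifts by `M` cancel, and `M → ∞` removes the truncation
(`lintegral_pos_add_neg_le`). -/

theorem abs_re_inner_le (R : H →L[ℂ] H) (f : H) :
    |RCLike.re ⟪f, R f⟫_ℂ| ≤ ‖f‖ * ‖R f‖ :=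
  (RCLike.abs_re_le_norm _).trans (norm_inner_le_norm _ _)

theorem IsResolvent.injective {A : H →ₗ.[ℂ] H} {R : H →L[ℂ] H}
    (hR : IsResolvent A R) {y : H} (hy : R y = 0) : y = 0 := by
  obtain ⟨x, hx, h⟩ := hR.2 y
  have : x = 0 := by ext; simp [hx, hy]
  simpa [this] using h.symm

end InnerProductSpace

/-! ### Resolvent, cutoffs and spectral projections -/

section Resolvent

variable {H : Type*} [NormedAddCommGroup H] [InnerProductSpace ℂ H] [CompleteSpace H]

theorem isFormalAdjoint_self {A : H →ₗ.[ℂ] H} (hA : IsSelfAdjoint A) : A.IsFormalAdjoint A := by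
  have h := LinearPMap.adjoint_isFormalAdjoint (T := A) hA.dense_domain
  rwa [LinearPMap.isSelfAdjoint_def.mp hA] at h

theorem isResolvent_resolvent {A : H →ₗ.[ℂ] H} (hA : IsSelfAdjoint A) :
    IsResolvent A (resolvent A) := by
  have h := exists_isResolvent hA
  rw [resolvent, dif_pos h]
  exact h.choose_spec

namespace IsResolvent

variable {A : H →ₗ.[ℂ] H} {R : H →L[ℂ] H}

theorem adjoint_sub_self (hA : IsSelfAdjoint A) (hR : IsResolvent A R) :
    star R - R = (2 * Complex.I) • (star R * R) := by
  ext y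
  refine ext_inner_left ℂ fun x => ?_
  obtain ⟨u, hu, hx⟩ := hR.2 x
  obtain ⟨v, hv, hy⟩ := hR.2 y
  have h := isFormalAdjoint_self hA u v
  simp only [sub_apply, smul_apply, mul_apply_eq_comp, ContinuousLinearMap.star_eq_adjoint,
    inner_sub_right, inner_smul_right, ContinuousLinearMap.adjoint_inner_right]
  rw [← hu, ← hv, ← hx, ← hy]
  simp only [inner_add_right, inner_add_left, inner_smul_left, inner_smul_right, Complex.conj_I]
  linear_combination -h

/-- Here symmetry of `A` is not enough: `R* w` is first found in the domain of the adjoint, which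
lies in the domain of `A` by self-adjointness. -/
theorem adjoint_mem (hA : IsSelfAdjoint A) (hR : IsResolvent A R) (w : H) :
    ∃ u : A.domain, (u : H) = star R w ∧ A u - Complex.I • (u : H) = w := by
  have key : ∀ x : A.domain, ⟪w + Complex.I • star R w, (x : H)⟫_ℂ = ⟪star R w, A x⟫_ℂ := by
    intro x
    have h1 : ⟪star R w, A x + Complex.I • (x : H)⟫_ℂ = ⟪w, (x : H)⟫_ℂ := by
      rw [ContinuousLinearMap.star_eq_adjoint, ContinuousLinearMap.adjoint_inner_left, hR.1]
    rw [inner_add_right, inner_smul_right] at h1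
    rw [inner_add_left, inner_smul_left, Complex.conj_I]
    linear_combination -h1
  have hmem : star R w ∈ A.adjoint.domain := LinearPMap.mem_adjoint_domain_of_exists _ ⟨_, key⟩
  have happ := LinearPMap.adjoint_apply_eq (T := A) hA.dense_domain (y := ⟨_, hmem⟩) key
  have hle : A.adjoint ≤ A := (LinearPMap.isSelfAdjoint_def.mp hA).le
  refine ⟨⟨star R w, hle.1 hmem⟩, rfl, ?_⟩
  rw [← hle.2 (x := ⟨star R w, hmem⟩) rfl, happ]
  simp

theorem adjoint_sub_self' (hA : IsSelfAdjoint A) (hR : IsResolvent A R) :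
    star R - R = (2 * Complex.I) • (R * star R) := by
  ext y
  refine ext_inner_left ℂ fun x => ?_
  obtain ⟨u, hu, hx⟩ := hR.adjoint_mem hA x
  obtain ⟨v, hv, hy⟩ := hR.adjoint_mem hA y
  have h := isFormalAdjoint_self hA u v
  have e : ∀ z, ⟪x, R z⟫_ℂ = ⟪star R x, z⟫_ℂ := fun z => by
    rw [ContinuousLinearMap.star_eq_adjoint, ContinuousLinearMap.adjoint_inner_left]
  simp only [sub_apply, smul_apply, mul_apply_eq_comp, inner_sub_right, inner_smul_right, e]
  rw [← hu, ← hv, ← hx, ← hy]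
  simp only [inner_sub_right, inner_sub_left, inner_smul_left, inner_smul_right, Complex.conj_I]
  linear_combination h

/-- Both `R* R` and `R R*` equal `(R* - R) / 2i`. Without normality the functional calculus in
`cutoff` would return its default value 0. -/
theorem isStarNormal (hA : IsSelfAdjoint A) (hR : IsResolvent A R) : IsStarNormal R := by
  refine ⟨?_⟩
  have h := (hR.adjoint_sub_self hA).symm.trans (hR.adjoint_sub_self' hA)
  exact smul_right_injective _ (show 2 * Complex.I ≠ 0 by simp) h

end IsResolvent

variable (A : H →ₗ.[ℂ] H)

/-- The companion of `cutoff`: the bounded positive operator `max(s - l, 0) / (1 + s²)` of `A`. -/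
def cocutoff (l : ℝ) : H →L[ℂ] H :=
  cfc (fun z : ℂ => ((max (z.re - l * ‖z‖ ^ 2) 0 : ℝ) : ℂ)) (resolvent A)

theorem cocutoff_nonneg (l : ℝ) : 0 ≤ cocutoff A l :=
  cfc_nonneg fun z _ => by
    rw [Complex.zero_le_real]; exact le_max_right _ _

theorem cocutoff_mul_cutoff (l : ℝ) : cocutoff A l * cutoff A l = 0 := by
  rw [cocutoff, cutoff, ← cfc_mul _ _ _ (Continuous.continuousOn (by fun_prop))
    (Continuous.continuousOn (by fun_prop))]
  refine (cfc_congr fun z _ => ?_).trans (cfc_zero ℂ (resolvent A))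
  simp only [Pi.zero_apply]
  rw [← Complex.ofReal_mul, Complex.ofReal_eq_zero, mul_eq_zero]
  rcases le_total (l * ‖z‖ ^ 2) z.re with h | h
  · right; rw [max_eq_right]; linarith
  · left; rw [max_eq_right]; linarith

variable {A}

/-- Positive part minus negative part leaves `(l - s) / (1 + s²)`, a polynomial in `z = (s + i)⁻¹`
and its conjugate; its quadratic form is affine in `l`. -/
theorem cutoff_sub_cocutoff (hA : IsSelfAdjoint A) (l : ℝ) :
    cutoff A l - cocutoff A l = (l : ℂ) • (star (resolvent A) * resolvent A) -
      (2⁻¹ : ℂ) • (resolvent A + star (resolvent A)) := by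
  have hn : IsStarNormal (resolvent A) := (isResolvent_resolvent hA).isStarNormal hA
  have c1 : ContinuousOn (fun z : ℂ => star z * z) (spectrum ℂ (resolvent A)) :=
    Continuous.continuousOn (by fun_prop)
  have c2 : ContinuousOn (fun z : ℂ => z + star z) (spectrum ℂ (resolvent A)) :=
    Continuous.continuousOn (by fun_prop)
  have e1 : star (resolvent A) * resolvent A = cfc (fun z : ℂ => star z * z) (resolvent A) := by
    rw [cfc_mul (fun z : ℂ => star z) (fun z => z) (resolvent A), cfc_star_id (resolvent A),
      cfc_id' ℂ (resolvent A)]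
  have e2 : resolvent A + star (resolvent A) = cfc (fun z : ℂ => z + star z) (resolvent A) := by
    rw [cfc_add (resolvent A) (fun z : ℂ => z) (fun z => star z), cfc_star_id (resolvent A),
      cfc_id' ℂ (resolvent A)]
  rw [e1, e2, ← cfc_smul _ _ _ c1, ← cfc_smul _ _ _ c2, cutoff, cocutoff,
    ← cfc_sub _ _ _ (Continuous.continuousOn (by fun_prop))
      (Continuous.continuousOn (by fun_prop)),
    ← cfc_sub _ _ _ (Continuous.continuousOn (by fun_prop))
      (Continuous.continuousOn (by fun_prop))]
  refine cfc_congr fun z _ => ?_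
  have h1 : star z * z = ((‖z‖ ^ 2 : ℝ) : ℂ) := by
    rw [Complex.star_def, Complex.conj_mul']; norm_cast
  have h2 : z + star z = ((2 * z.re : ℝ) : ℂ) := Complex.add_conj z
  simp only [smul_eq_mul, h1, h2]
  rcases le_total (l * ‖z‖ ^ 2) z.re with h | h
  · rw [max_eq_right (by linarith), max_eq_left (by linarith)]
    push_cast; ring
  · rw [max_eq_left (by linarith), max_eq_right (by linarith)]
    push_cast; ring

theorem re_inner_cutoff_sub_cocutoff (hA : IsSelfAdjoint A) (l : ℝ) (f : H) :
    RCLike.re ⟪f, (cutoff A l - cocutoff A l) f⟫_ℂ =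
      l * ‖resolvent A f‖ ^ 2 - RCLike.re ⟪f, resolvent A f⟫_ℂ := by
  rw [cutoff_sub_cocutoff hA]
  simp only [sub_apply, smul_apply, add_apply, mul_apply_eq_comp,
    ContinuousLinearMap.star_eq_adjoint, inner_sub_right, inner_smul_right, inner_add_right,
    ContinuousLinearMap.adjoint_inner_right, inner_self_eq_norm_sq_to_K, map_sub]
  rw [← inner_conj_symm (resolvent A f) f, Complex.add_conj]
  congr 1
  · rw [← RCLike.ofReal_pow]
    exact RCLike.re_ofReal_mul _ _ |>.trans (by simp [-Complex.ofReal_pow])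
  · have : (2⁻¹ : ℂ) * ((2 * (⟪f, resolvent A f⟫_ℂ).re : ℝ) : ℂ) =
        ((⟪f, resolvent A f⟫_ℂ).re : ℂ) := by
      push_cast; ring
    rw [this]; simp

/-- If every cutoff kills `f`, then `l ‖R f‖² - re ⟪f, R f⟫ ≤ 0` for all `l`, which forces `R f =
0`. -/
theorem iInf_ker_cutoff (hA : IsSelfAdjoint A) : ⨅ l, (cutoff A l).ker = ⊥ := by
  rw [Submodule.eq_bot_iff]
  intro f hf
  rw [Submodule.mem_iInf] at hf
  refine (isResolvent_resolvent hA).injective ?_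
  by_contra h0
  have hpos : 0 < ‖resolvent A f‖ := norm_pos_iff.mpr h0
  set C := ‖f‖ * ‖resolvent A f‖ with hC
  have key : ∀ l : ℝ, l * ‖resolvent A f‖ ^ 2 ≤ C := by
    intro l
    have h1 := re_inner_cutoff_sub_cocutoff hA l f
    have h2 : cutoff A l f = 0 := hf l
    have h3 := ((ContinuousLinearMap.nonneg_iff_isPositive _).mp
      (cocutoff_nonneg A l)).re_inner_nonneg_right f
    have h4 := (abs_le.mp (abs_re_inner_le (resolvent A) f)).2
    rw [sub_apply, h2, zero_sub, inner_neg_right, map_neg] at h1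
    linarith
  -- This `l` turns the bound into `C + 1 ≤ C`.
  have := key ((C + 1) / ‖resolvent A f‖ ^ 2)
  rw [div_mul_cancel₀ _ (by positivity)] at this
  linarith

theorem iInf_ker_cutoff_orthogonal (hA : IsSelfAdjoint A) : ⨅ l, (cutoff A l).kerᗮ = ⊥ := by
  rw [Submodule.eq_bot_iff]
  intro f hf
  rw [Submodule.mem_iInf] at hf
  refine (isResolvent_resolvent hA).injective ?_
  by_contra h0
  have hpos : 0 < ‖resolvent A f‖ := norm_pos_iff.mpr h0
  set C := ‖f‖ * ‖resolvent A f‖ with hC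
  have key : ∀ l : ℝ, -C ≤ l * ‖resolvent A f‖ ^ 2 := by
    intro l
    have h1 := re_inner_cutoff_sub_cocutoff hA l f
    have hp := (ContinuousLinearMap.nonneg_iff_isPositive _).mp (cocutoff_nonneg A l)
    have hq := (ContinuousLinearMap.nonneg_iff_isPositive _).mp (cutoff_nonneg A l)
    have hz : cutoff A l * cocutoff A l = 0 := by
      have h := congrArg star (cocutoff_mul_cutoff A l)
      rwa [star_mul, star_zero, hp.isSelfAdjoint.star_eq, hq.isSelfAdjoint.star_eq] at h
    -- The range of the cocutoff lies in the kernel of the cutoff, to which `f` is orthogonal.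
    have h2 : cocutoff A l f = 0 := by
      refine ext_inner_left ℂ fun x => ?_
      rw [inner_zero_right]
      have h5 : cocutoff A l x ∈ (cutoff A l).ker := by
        change (cutoff A l * cocutoff A l) x = 0
        rw [hz]; rfl
      have h6 := (Submodule.mem_orthogonal _ _).mp (hf l) _ h5
      rw [← h6]
      exact (hp.isSymmetric x f).symm
    have h3 := hq.re_inner_nonneg_right f
    have h4 := (abs_le.mp (abs_re_inner_le (resolvent A) f)).1
    rw [sub_apply, h2, sub_zero] at h1
    linarith
  have := key (-(C + 1) / ‖resolvent A f‖ ^ 2)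
  rw [div_mul_cancel₀ _ (by positivity)] at this
  linarith

theorem ker_cutoff_antitone (A : H →ₗ.[ℂ] H) : Antitone fun l => (cutoff A l).ker := by
  intro l m hlm x hx
  have h1 := (ContinuousLinearMap.nonneg_iff_isPositive _).mp (cutoff_nonneg A l)
  have h2 : (cutoff A m - cutoff A l).IsPositive :=
    (ContinuousLinearMap.le_def _ _).mp (cutoff_mono A hlm)
  have hx0 : cutoff A m x = 0 := hx
  have h3 := h2.re_inner_nonneg_left x
  have h5 : RCLike.re ⟪cutoff A l x, x⟫_ℂ = 0 := by
    refine le_antisymm ?_ (h1.re_inner_nonneg_left x)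
    simpa [hx0] using h3
  obtain ⟨S, hS⟩ := (CStarAlgebra.nonneg_iff_eq_star_mul_self).mp (cutoff_nonneg A l)
  have h6 : S x = 0 := by
    rw [hS, mul_apply_eq_comp, ContinuousLinearMap.star_eq_adjoint,
      ContinuousLinearMap.adjoint_inner_left, inner_self_eq_norm_sq] at h5
    simpa using h5
  change cutoff A l x = 0
  rw [hS, mul_apply_eq_comp, h6, map_zero]

theorem spectralProjection_mul_of_le (A : H →ₗ.[ℂ] H) {l m : ℝ} (hlm : l ≤ m) :
    spectralProjection A m * spectralProjection A l = spectralProjection A l := by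
  have hle : (cutoff A l).kerᗮ ≤ (cutoff A m).kerᗮ :=
    Submodule.orthogonal_le (ker_cutoff_antitone A hlm)
  ext f
  change (cutoff A m).kerᗮ.starProjection ((cutoff A l).kerᗮ.starProjection f) = _
  exact Submodule.starProjection_eq_self_iff.mpr (hle (Submodule.starProjection_apply_mem _ _))

theorem norm_spectralProjection_le (A : H →ₗ.[ℂ] H) (l : ℝ) : ‖spectralProjection A l‖ ≤ 1 :=
  Submodule.starProjection_norm_le _

theorem norm_sq_sub_spectralProjection (A : H →ₗ.[ℂ] H) (l : ℝ) (f : H) :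
    ‖f - spectralProjection A l f‖ ^ 2 = ‖f‖ ^ 2 - ‖spectralProjection A l f‖ ^ 2 := by
  have h := Submodule.norm_sq_eq_add_norm_sq_starProjection f (cutoff A l).kerᗮ
  rw [Submodule.starProjection_orthogonal (cutoff A l).kerᗮ] at h
  change ‖f‖ ^ 2 = ‖spectralProjection A l f‖ ^ 2 + ‖f - spectralProjection A l f‖ ^ 2 at h
  linarith

theorem closed_ker_orthogonal_orthogonal (T : H →L[ℂ] H) : T.kerᗮᗮ = T.ker := by
  have : CompleteSpace T.ker := (ContinuousLinearMap.isClosed_ker T).completeSpace_coe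
  exact Submodule.orthogonal_orthogonal _

theorem top_le_topologicalClosure_of_orthogonal_eq_bot {K : Submodule ℂ H} (h : Kᗮ = ⊥) :
    ⊤ ≤ K.topologicalClosure := by
  rw [← Submodule.orthogonal_orthogonal_eq_closure, h, Submodule.bot_orthogonal_eq_top]

theorem tendsto_spectralProjection_atTop (hA : IsSelfAdjoint A) (f : H) :
    Filter.Tendsto (fun l => spectralProjection A l f) Filter.atTop (nhds f) := by
  refine Submodule.starProjection_tendsto_self (fun l => (cutoff A l).kerᗮ)
    (fun l m hlm => Submodule.orthogonal_le (ker_cutoff_antitone A hlm)) f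
    (top_le_topologicalClosure_of_orthogonal_eq_bot ?_)
  rw [← Submodule.iInf_orthogonal]
  simp_rw [closed_ker_orthogonal_orthogonal]
  exact iInf_ker_cutoff hA

theorem tendsto_spectralProjection_atBot (hA : IsSelfAdjoint A) (f : H) :
    Filter.Tendsto (fun l => spectralProjection A l f) Filter.atBot (nhds 0) := by
  have hc : ∀ l, CompleteSpace (cutoff A l).ker := fun l =>
    (ContinuousLinearMap.isClosed_ker _).completeSpace_coe
  have h : Filter.Tendsto (fun l : ℝ => (cutoff A (-l)).ker.starProjection f) Filter.atTop
      (nhds f) := by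
    refine Submodule.starProjection_tendsto_self (fun l : ℝ => (cutoff A (-l)).ker)
      (fun l m hlm => ker_cutoff_antitone A (neg_le_neg hlm)) f
      (top_le_topologicalClosure_of_orthogonal_eq_bot ?_)
    rw [← Submodule.iInf_orthogonal, ← iInf_ker_cutoff_orthogonal hA]
    exact neg_surjective.iInf_comp (fun l => (cutoff A l).kerᗮ)
  have h2 := (h.comp Filter.tendsto_neg_atBot_atTop).const_sub f
  rw [sub_self] at h2
  refine h2.congr fun l => ?_
  simp only [Function.comp, neg_neg, spectralProjection]
  rw [Submodule.starProjection_orthogonal]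
  rfl

theorem tendsto_norm_sq_spectralProjection_atTop (hA : IsSelfAdjoint A) (f : H) :
    Filter.Tendsto (norm_spectralProjection_mono A f).stieltjesFunction Filter.atTop
      (nhds (‖f‖ ^ 2)) := by
  have h := ((tendsto_spectralProjection_atTop hA f).norm.pow 2)
  exact (tendsto_rightLim_atTop_of_tendsto h).congr fun x =>
    ((norm_spectralProjection_mono A f).stieltjesFunction_eq x).symm

theorem vectorSpectralMeasure_univ (hA : IsSelfAdjoint A) (f : H) :
    vectorSpectralMeasure A f Set.univ = ‖f‖ₑ ^ 2 := by
  have h := ((tendsto_spectralProjection_atBot hA f).norm.pow 2)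
  rw [vectorSpectralMeasure, StieltjesFunction.measure_univ _
    ((tendsto_rightLim_atBot_of_tendsto h).congr fun x =>
      ((norm_spectralProjection_mono A f).stieltjesFunction_eq x).symm)
    (tendsto_norm_sq_spectralProjection_atTop hA f)]
  simp [ENNReal.ofReal_pow]

/-- The Stieltjes function is the right limit of `‖Π_l f‖²`, and its left limit at `l` is at most
`‖Π_l f‖²`. Only this inequality is needed, so left continuity of `Π_l` plays no role. -/
theorem le_vectorSpectralMeasure_Ici (hA : IsSelfAdjoint A) (f : H) (l : ℝ) :
    ‖f - spectralProjection A l f‖ₑ ^ 2 ≤ vectorSpectralMeasure A f (Set.Ici l) := by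
  rw [vectorSpectralMeasure, StieltjesFunction.measure_Ici _
    (tendsto_norm_sq_spectralProjection_atTop hA f), ← ofReal_norm,
    ← ENNReal.ofReal_pow (norm_nonneg _), norm_sq_sub_spectralProjection]
  refine ENNReal.ofReal_le_ofReal (sub_le_sub_left ?_ _)
  have hm := norm_spectralProjection_mono A f
  refine le_of_tendsto (hm.stieltjesFunction.mono.tendsto_leftLim l) ?_
  filter_upwards [self_mem_nhdsWithin] with y hy
  rw [hm.stieltjesFunction_eq]
  exact hm.rightLim_le hy

end Resolvent

/-! ### Hilbert-Schmidt sums -/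

section HilbertSchmidt

variable {H : Type*} [NormedAddCommGroup H] [InnerProductSpace ℂ H]
  {K : Type*} [NormedAddCommGroup K] [InnerProductSpace ℂ K]
  {ι κ : Type*}

theorem tsum_enorm_inner_sq (b : HilbertBasis ι ℂ H) (x : H) :
    ∑' i, ‖⟪b i, x⟫_ℂ‖ₑ ^ 2 = ‖x‖ₑ ^ 2 := by
  have h := (RCLike.hasSum_re ℂ (b.hasSum_inner_mul_inner x x))
  have e : ∀ i, RCLike.re (⟪x, b i⟫_ℂ * ⟪b i, x⟫_ℂ) = ‖⟪b i, x⟫_ℂ‖ ^ 2 := fun i => by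
    rw [← inner_conj_symm x (b i), RCLike.conj_mul, ← RCLike.ofReal_pow, RCLike.ofReal_re]
  simp only [e, inner_self_eq_norm_sq] at h
  rw [← ofReal_norm, ← ENNReal.ofReal_pow (norm_nonneg _), ← h.tsum_eq,
    ENNReal.ofReal_tsum_of_nonneg (fun i => by positivity) h.summable]
  refine tsum_congr fun i => ?_
  rw [← ofReal_norm, ENNReal.ofReal_pow (norm_nonneg _)]

theorem tsum_enorm_sq_adjoint [CompleteSpace H] [CompleteSpace K] (b : HilbertBasis ι ℂ H)
    (c : HilbertBasis κ ℂ K) (T : H →L[ℂ] K) :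
    ∑' i, ‖T (b i)‖ₑ ^ 2 = ∑' j, ‖ContinuousLinearMap.adjoint T (c j)‖ₑ ^ 2 := by
  simp_rw [← tsum_enorm_inner_sq c, ← tsum_enorm_inner_sq b]
  rw [ENNReal.tsum_comm]
  refine tsum_congr fun j => tsum_congr fun i => ?_
  rw [ContinuousLinearMap.adjoint_inner_right, ← inner_conj_symm, RCLike.enorm_conj]

/-- Passing to adjoints puts `S` on the outside, where its operator norm can be pulled out of each
term. -/
theorem tsum_enorm_sq_comp_le [CompleteSpace H] [CompleteSpace K] (b : HilbertBasis ι ℂ H)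
    (T : H →L[ℂ] K) (S : H →L[ℂ] H) :
    ∑' i, ‖T (S (b i))‖ₑ ^ 2 ≤ ‖S‖ₑ ^ 2 * ∑' i, ‖T (b i)‖ₑ ^ 2 := by
  obtain ⟨w, c, -⟩ := exists_hilbertBasis ℂ K
  have h := tsum_enorm_sq_adjoint b c (T.comp S)
  simp only [ContinuousLinearMap.comp_apply, ContinuousLinearMap.adjoint_comp] at h
  rw [h, tsum_enorm_sq_adjoint b c T, ← ENNReal.tsum_mul_left]
  refine ENNReal.tsum_le_tsum fun j => ?_
  rw [← mul_pow]
  have hS : ‖ContinuousLinearMap.adjoint S‖ₑ = ‖S‖ₑ :=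
    enorm_eq_iff_norm_eq.mpr (LinearIsometryEquiv.norm_map ContinuousLinearMap.adjoint S)
  rw [← hS]
  gcongr
  exact ContinuousLinearMap.le_opENorm _ _

variable [CompleteSpace H]

theorem isSelfAdjoint_sqrt (P : H →L[ℂ] H) : IsSelfAdjoint (CFC.sqrt P) :=
  IsSelfAdjoint.of_nonneg (CFC.sqrt_nonneg P)

theorem sqrt_eq_self_of_isStarProjection {P : H →L[ℂ] H} (hP : IsStarProjection P) :
    CFC.sqrt P = P :=
  CFC.sqrt_unique hP.isIdempotentElem hP.nonneg

theorem enorm_sqrt_sq {ρ : H →L[ℂ] H} (hρ : ρ.IsPositive) : ‖CFC.sqrt ρ‖ₑ ^ 2 = ‖ρ‖ₑ := by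
  have h0 : 0 ≤ ρ := (ContinuousLinearMap.nonneg_iff_isPositive _).mpr hρ
  have h1 : CFC.sqrt ρ * star (CFC.sqrt ρ) = ρ := by
    rw [(isSelfAdjoint_sqrt ρ).star_eq, CFC.sqrt_mul_sqrt_self ρ h0]
  have h2 : ‖ρ‖ = ‖CFC.sqrt ρ‖ ^ 2 := by
    conv_lhs => rw [← h1]
    rw [CStarRing.norm_self_mul_star, sq]
  rw [← ofReal_norm, ← ofReal_norm, h2, ENNReal.ofReal_pow (norm_nonneg _)]

theorem tsum_enorm_sq_sqrtBasis_le [CompleteSpace K] (T : H →L[ℂ] K) {ρ : H →L[ℂ] H}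
    (hρ : ρ.IsPositive) :
    ∑' i, ‖T (sqrtBasis ρ i)‖ₑ ^ 2 ≤ ‖ρ‖ₑ * ∑' i, ‖T (basis H i)‖ₑ ^ 2 := by
  rw [← enorm_sqrt_sq hρ]
  exact tsum_enorm_sq_comp_le (basis H) T (CFC.sqrt ρ)

theorem trace_eq_tsum_sqrtBasis {ρ : H →L[ℂ] H} (hρ : ρ.IsPositive) :
    trace ρ = ∑' i, ‖sqrtBasis ρ i‖ₑ ^ 2 := by
  have h0 : 0 ≤ ρ := (ContinuousLinearMap.nonneg_iff_isPositive _).mpr hρ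
  refine tsum_congr fun i => ?_
  have h1 : ⟪basis H i, ρ (basis H i)⟫_ℂ = ⟪sqrtBasis ρ i, sqrtBasis ρ i⟫_ℂ := by
    conv_lhs => rw [← CFC.sqrt_mul_sqrt_self ρ h0]
    rw [mul_apply_eq_comp, ← (isSelfAdjoint_sqrt ρ).star_eq, ContinuousLinearMap.star_eq_adjoint,
      ContinuousLinearMap.adjoint_inner_right, ← ContinuousLinearMap.star_eq_adjoint,
      (isSelfAdjoint_sqrt ρ).star_eq]
    rfl
  rw [h1, inner_self_eq_norm_sq, ENNReal.ofReal_pow (norm_nonneg _), ofReal_norm]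

theorem isStarProjection_spectralProjection (A : H →ₗ.[ℂ] H) (l : ℝ) :
    IsStarProjection (spectralProjection A l) := isStarProjection_starProjection

theorem sqrtBasis_spectralProjection (A : H →ₗ.[ℂ] H) (l : ℝ) (i : basisIndex H) :
    sqrtBasis (spectralProjection A l) i = spectralProjection A l (basis H i) := by
  rw [sqrtBasis, sqrt_eq_self_of_isStarProjection (isStarProjection_spectralProjection A l)]

theorem energyDistribution_univ {A : H →ₗ.[ℂ] H} (hA : IsSelfAdjoint A) {ρ : H →L[ℂ] H}
    (hρ : ρ.IsPositive) : energyDistribution A ρ Set.univ = trace ρ := by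
  rw [energyDistribution, Measure.sum_apply _ MeasurableSet.univ, trace_eq_tsum_sqrtBasis hρ]
  simp_rw [vectorSpectralMeasure_univ hA]

theorem tsum_sub_spectralProjection_le {A : H →ₗ.[ℂ] H} (hA : IsSelfAdjoint A) (ρ : H →L[ℂ] H)
    (l : ℝ) : ∑' i, ‖sqrtBasis ρ i - spectralProjection A l (sqrtBasis ρ i)‖ₑ ^ 2 ≤
      energyDistribution A ρ (Set.Ici l) := by
  rw [energyDistribution, Measure.sum_apply _ measurableSet_Ici]
  exact ENNReal.tsum_le_tsum fun i => le_vectorSpectralMeasure_Ici hA _ l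

end HilbertSchmidt

/-! ### Densities of measures that need not be σ-finite -/

section LebesgueDecomposition

variable {X : Type*} [MeasurableSpace X]

/-- Off the set where `m` is σ-finite relative to `μ`, `m` is `∞ • μ`, which has density `∞`. This
covers `ν_{Π_l}`, whose density may be infinite. -/
theorem haveLebesgueDecomposition_of_absolutelyContinuous {m μ : Measure X} [SigmaFinite μ]
    (h : m ≪ μ) : m.HaveLebesgueDecomposition μ := by
  set S := m.sigmaFiniteSetWRT μ with hS
  have hSm : MeasurableSet S := measurableSet_sigmaFiniteSetWRT
  have h1 : (m.restrict Sᶜ).HaveLebesgueDecomposition μ := by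
    rw [hS, restrict_compl_sigmaFiniteSetWRT h, ← withDensity_const,
      ← withDensity_indicator measurableSet_sigmaFiniteSetWRT.compl]
    exact Measure.haveLebesgueDecomposition_withDensity μ
      (measurable_const.indicator measurableSet_sigmaFiniteSetWRT.compl)
  have h2 : (m.restrict S).HaveLebesgueDecomposition μ := inferInstance
  rw [← Measure.restrict_add_restrict_compl (μ := m) hSm]
  infer_instance

theorem ae_le_of_withDensity_le {μ : Measure X} [SigmaFinite μ] {f g : X → ℝ≥0∞}
    (hf : Measurable f) (h : ∀ s, MeasurableSet s → μ.withDensity f s ≤ μ.withDensity g s) :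
    f ≤ᵐ[μ] g :=
  ae_le_of_forall_setLIntegral_le_of_sigmaFinite hf fun s hs _ => by
    simpa only [withDensity_apply _ hs] using h s hs

end LebesgueDecomposition

/-! ### Spatial densities and the spectral density function -/

section Density

variable {X : Type*} [MeasurableSpace X] {μ : Measure X}
  {V : Type*} [NormedAddCommGroup V]

theorem lintegral_enorm_sq_eq (f : Lp V 2 μ) : ∫⁻ x, ‖f x‖ₑ ^ 2 ∂μ = ‖f‖ₑ ^ 2 := by
  rw [Lp.enorm_def, eLpNorm_eq_lintegral_rpow_enorm_toReal (by norm_num) (by norm_num),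
    ← ENNReal.rpow_two, ← ENNReal.rpow_mul]
  simp

theorem measurable_enorm_sq (f : Lp V 2 μ) : Measurable fun x => ‖f x‖ₑ ^ 2 :=
  (Lp.stronglyMeasurable f).enorm.pow_const 2

variable [InnerProductSpace ℂ V]

variable (μ V) in
/-- Restriction of functions to a subset. -/
def restrictCLM (E : Set X) : Lp V 2 μ →L[ℂ] Lp V 2 (μ.restrict E) :=
  LpToLpRestrictCLM X V ℂ μ 2 E

theorem setLIntegral_enorm_sq_eq (f : Lp V 2 μ) (E : Set X) :
    ∫⁻ x in E, ‖f x‖ₑ ^ 2 ∂μ = ‖restrictCLM μ V E f‖ₑ ^ 2 := by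
  rw [← lintegral_enorm_sq_eq]
  refine lintegral_congr_ae ?_
  filter_upwards [LpToLpRestrictCLM_coeFn (p := 2) (μ := μ) ℂ E f] with x hx
  rw [restrictCLM, hx]

variable [CompleteSpace V]

theorem densityMeasure_apply (P : Lp V 2 μ →L[ℂ] Lp V 2 μ) {E : Set X} (hE : MeasurableSet E) :
    densityMeasure P E = ∑' i, ‖restrictCLM μ V E (sqrtBasis P i)‖ₑ ^ 2 := by
  rw [densityMeasure, Measure.sum_apply _ hE]
  exact tsum_congr fun i => by rw [withDensity_apply _ hE, setLIntegral_enorm_sq_eq]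

theorem densityMeasure_univ {ρ : Lp V 2 μ →L[ℂ] Lp V 2 μ} (hρ : ρ.IsPositive) :
    densityMeasure ρ Set.univ = trace ρ := by
  rw [trace_eq_tsum_sqrtBasis hρ, densityMeasure, Measure.sum_apply _ MeasurableSet.univ]
  exact tsum_congr fun i => by
    rw [withDensity_apply _ MeasurableSet.univ, Measure.restrict_univ, lintegral_enorm_sq_eq]

theorem densityMeasure_absolutelyContinuous (P : Lp V 2 μ →L[ℂ] Lp V 2 μ) :
    densityMeasure P ≪ μ :=
  Measure.absolutelyContinuous_sum_left fun _ => withDensity_absolutelyContinuous _ _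

theorem withDensity_density [SigmaFinite μ] (P : Lp V 2 μ →L[ℂ] Lp V 2 μ) :
    μ.withDensity (density P) = densityMeasure P := by
  have h := densityMeasure_absolutelyContinuous P
  have := haveLebesgueDecomposition_of_absolutelyContinuous h
  exact Measure.withDensity_rnDeriv_eq _ _ h

theorem measurable_density (P : Lp V 2 μ →L[ℂ] Lp V 2 μ) : Measurable (density P) :=
  Measure.measurable_rnDeriv _ _

theorem densityMeasure_spectralProjection_apply (A : Lp V 2 μ →ₗ.[ℂ] Lp V 2 μ) (l : ℝ) {E : Set X}
    (hE : MeasurableSet E) : densityMeasure (spectralProjection A l) E =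
      ∑' i, ‖((restrictCLM μ V E).comp (spectralProjection A l)) (basis _ i)‖ₑ ^ 2 := by
  rw [densityMeasure_apply _ hE]
  simp_rw [sqrtBasis_spectralProjection]
  rfl

/-- Since `Π_l = Π_m Π_l` and `‖Π_l‖ ≤ 1`, the Hilbert-Schmidt norm of `χ_E Π_l` is at most that of
`χ_E Π_m`, for every `E`. -/
theorem spectralDensity_mono [SigmaFinite μ] (A : Lp V 2 μ →ₗ.[ℂ] Lp V 2 μ) :
    Monotone (spectralDensity A) := by
  intro l m hlm
  refine essSup_mono_ae (ae_le_of_withDensity_le (measurable_density _) fun E hE => ?_)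
  rw [withDensity_density, withDensity_density, densityMeasure_spectralProjection_apply A l hE,
    densityMeasure_spectralProjection_apply A m hE]
  have h := tsum_enorm_sq_comp_le (basis (Lp V 2 μ))
    ((restrictCLM μ V E).comp (spectralProjection A m)) (spectralProjection A l)
  simp only [ContinuousLinearMap.comp_apply] at h ⊢
  simp only [← mul_apply_eq_comp, spectralProjection_mul_of_le A hlm] at h
  refine h.trans (mul_le_of_le_one_left' (pow_le_one' ?_ 2))
  rw [← ofReal_norm]
  exact ENNReal.ofReal_le_one.mpr (norm_spectralProjection_le A l)

theorem densityMeasure_spectralProjection_le [SigmaFinite μ] (A : Lp V 2 μ →ₗ.[ℂ] Lp V 2 μ)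
    (l : ℝ) {E : Set X} (hE : MeasurableSet E) :
    densityMeasure (spectralProjection A l) E ≤ spectralDensity A l * μ E := by
  rw [← withDensity_density, withDensity_apply _ hE, ← setLIntegral_const]
  exact setLIntegral_mono_ae measurable_const.aemeasurable
    ((ENNReal.ae_le_essSup _).mono fun x hx _ => hx)

theorem tsum_setLIntegral_spectralProjection_le [SigmaFinite μ] (A : Lp V 2 μ →ₗ.[ℂ] Lp V 2 μ)
    (l : ℝ) {ρ : Lp V 2 μ →L[ℂ] Lp V 2 μ} (hρ : ρ.IsPositive) {E : Set X} (hE : MeasurableSet E) :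
    ∑' i, ∫⁻ x in E, ‖spectralProjection A l (sqrtBasis ρ i) x‖ₑ ^ 2 ∂μ ≤
      ‖ρ‖ₑ * spectralDensity A l * μ E := by
  simp_rw [setLIntegral_enorm_sq_eq]
  refine (tsum_enorm_sq_sqrtBasis_le
    ((restrictCLM μ V E).comp (spectralProjection A l)) hρ).trans ?_
  rw [← densityMeasure_spectralProjection_apply A l hE, mul_assoc]
  gcongr
  exact densityMeasure_spectralProjection_le A l hE

end Density

/-- Minkowski's inequality for counting measure. -/
theorem rpow_tsum_add_sq_le {ι : Type*} (a b : ι → ℝ≥0∞) :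
    (∑' i, (a i + b i) ^ 2) ^ (1 / 2 : ℝ) ≤
      (∑' i, a i ^ 2) ^ (1 / 2 : ℝ) + (∑' i, b i ^ 2) ^ (1 / 2 : ℝ) := by
  let _ : MeasurableSpace ι := ⊤
  have h := ENNReal.lintegral_Lp_add_le (μ := Measure.count) (p := 2) (f := a) (g := b)
    (measurable_from_top.aemeasurable) (measurable_from_top.aemeasurable) (by norm_num)
  simpa only [lintegral_count, ENNReal.rpow_two, Pi.add_apply] using h

/-! ### The level inequality -/

section

variable {X : Type*} [MeasurableSpace X] {μ : Measure X}
  {V : Type*} [NormedAddCommGroup V] [InnerProductSpace ℂ V] [CompleteSpace V]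
  {A : Lp V 2 μ →ₗ.[ℂ] Lp V 2 μ} {ρ : Lp V 2 μ →L[ℂ] Lp V 2 μ}

/-- The indices of the nonzero vectors `P^{1/2} eᵢ`. -/
def sqrtSupport (P : Lp V 2 μ →L[ℂ] Lp V 2 μ) : Set (basisIndex (Lp V 2 μ)) :=
  {i | sqrtBasis P i ≠ 0}

/-- The Hilbert basis may be uncountable; finite trace leaves countably many nonzero vectors, so
sums commute with integrals and null sets can be united. -/
theorem countable_sqrtSupport (hρ : IsState ρ) : (sqrtSupport ρ).Countable := by
  have h := hρ.trace_ne_top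
  rw [trace_eq_tsum_sqrtBasis hρ.isPositive] at h
  refine (Summable.countable_support_ennreal h).mono fun i hi => ?_
  simpa [Function.mem_support, sqrtSupport] using hi

theorem densityMeasure_eq_sum_sqrtSupport (P : Lp V 2 μ →L[ℂ] Lp V 2 μ) :
    densityMeasure P =
      Measure.sum fun i : sqrtSupport P => μ.withDensity fun x => ‖sqrtBasis P i x‖ₑ ^ 2 := by
  ext E hE
  rw [densityMeasure, Measure.sum_apply _ hE, Measure.sum_apply _ hE]
  refine (tsum_subtype_eq_of_support_subset (s := sqrtSupport P)
    (f := fun i => μ.withDensity (fun x => ‖sqrtBasis P i x‖ₑ ^ 2) E) fun i hi h0 => hi ?_).symm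
  dsimp only
  rw [withDensity_apply _ hE, setLIntegral_enorm_sq_eq, h0]
  simp

theorem density_ae_eq [SigmaFinite μ] (hρ : IsState ρ) :
    density ρ =ᵐ[μ] fun x => ∑' i : sqrtSupport ρ, ‖sqrtBasis ρ i x‖ₑ ^ 2 := by
  have := (countable_sqrtSupport hρ).to_subtype
  have hsum : ∑' i : sqrtSupport ρ, (fun x => ‖sqrtBasis ρ i x‖ₑ ^ 2) =
      fun x => ∑' i : sqrtSupport ρ, ‖sqrtBasis ρ i x‖ₑ ^ 2 := by
    ext x
    exact tsum_apply (Pi.summable.mpr fun _ => ENNReal.summable)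
  rw [density, densityMeasure_eq_sum_sqrtSupport,
    ← withDensity_tsum fun i : sqrtSupport ρ => measurable_enorm_sq (sqrtBasis ρ i), hsum]
  exact Measure.rnDeriv_withDensity μ (Measurable.tsum fun i => measurable_enorm_sq _)

theorem tsum_enorm_sq_spectralProjection_ae_le [SigmaFinite μ] (hρ : IsState ρ) (l : ℝ) :
    ∀ᵐ x ∂μ, ∑' i : sqrtSupport ρ, ‖spectralProjection A l (sqrtBasis ρ i) x‖ₑ ^ 2 ≤
      ‖ρ‖ₑ * spectralDensity A l := by
  have := (countable_sqrtSupport hρ).to_subtype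
  refine ae_le_of_forall_setLIntegral_le_of_sigmaFinite
    (Measurable.tsum fun i => measurable_enorm_sq _) fun E hE _ => ?_
  rw [lintegral_tsum fun i => (measurable_enorm_sq _).aemeasurable, setLIntegral_const]
  exact (ENNReal.tsum_comp_le_tsum_of_injective Subtype.val_injective _).trans
    (tsum_setLIntegral_spectralProjection_le A l hρ.isPositive hE)

theorem lintegral_sq_sub_le_of_spectralDensity_le [SigmaFinite μ] (hA : IsSelfAdjoint A)
    (hρ : IsState ρ) {l : ℝ} {c : ℝ≥0∞} (hc : spectralDensity A l ≤ c) :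
    ∫⁻ x, (density ρ x ^ (1 / 2 : ℝ) - (‖ρ‖ₑ * c) ^ (1 / 2 : ℝ)) ^ 2 ∂μ ≤
      energyDistribution A ρ (Set.Ici l) := by
  have := (countable_sqrtSupport hρ).to_subtype
  set P := spectralProjection A l with hP
  have hsub : ∀ᵐ x ∂μ, ∀ i : sqrtSupport ρ,
      sqrtBasis ρ i x = P (sqrtBasis ρ i) x + (sqrtBasis ρ i - P (sqrtBasis ρ i) : Lp V 2 μ) x := by
    rw [ae_all_iff]
    intro i
    filter_upwards [Lp.coeFn_sub (sqrtBasis ρ i) (P (sqrtBasis ρ i))] with x hx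
    rw [hx, Pi.sub_apply, add_sub_cancel]
  calc ∫⁻ x, (density ρ x ^ (1 / 2 : ℝ) - (‖ρ‖ₑ * c) ^ (1 / 2 : ℝ)) ^ 2 ∂μ
      ≤ ∫⁻ x, ∑' i : sqrtSupport ρ,
          ‖(sqrtBasis ρ i - P (sqrtBasis ρ i) : Lp V 2 μ) x‖ₑ ^ 2 ∂μ := by
        refine lintegral_mono_ae ?_
        filter_upwards [hsub, density_ae_eq hρ, tsum_enorm_sq_spectralProjection_ae_le (A := A) hρ l]
          with x h1 h2 h3
        set D := ∑' i : sqrtSupport ρ, ‖(sqrtBasis ρ i - P (sqrtBasis ρ i) : Lp V 2 μ) x‖ₑ ^ 2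
        have h4 : density ρ x ^ (1 / 2 : ℝ) ≤ (‖ρ‖ₑ * c) ^ (1 / 2 : ℝ) + D ^ (1 / 2 : ℝ) := by
          rw [h2]
          refine le_trans ?_ ((rpow_tsum_add_sq_le
            (fun i : sqrtSupport ρ => ‖P (sqrtBasis ρ i) x‖ₑ)
            (fun i => ‖(sqrtBasis ρ i - P (sqrtBasis ρ i) : Lp V 2 μ) x‖ₑ)).trans ?_)
          · gcongr with i
            rw [h1 i]
            exact enorm_add_le _ _
          · gcongr
            exact h3.trans (by gcongr)
        calc _ ≤ (D ^ (1 / 2 : ℝ)) ^ 2 := by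
              gcongr
              exact tsub_le_iff_left.mpr h4
          _ = D := by rw [← ENNReal.rpow_two, ← ENNReal.rpow_mul]; simp
    _ = ∑' i : sqrtSupport ρ, ‖sqrtBasis ρ i - P (sqrtBasis ρ i)‖ₑ ^ 2 := by
        rw [lintegral_tsum fun i => (measurable_enorm_sq _).aemeasurable]
        simp_rw [lintegral_enorm_sq_eq]
    _ ≤ ∑' i, ‖sqrtBasis ρ i - P (sqrtBasis ρ i)‖ₑ ^ 2 :=
        ENNReal.tsum_comp_le_tsum_of_injective Subtype.val_injective _
    _ ≤ _ := tsum_sub_spectralProjection_le hA ρ l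

theorem lintegral_density [SigmaFinite μ] (hρ : ρ.IsPositive) : ∫⁻ x, density ρ x ∂μ = trace ρ := by
  rw [← densityMeasure_univ hρ, ← withDensity_density, withDensity_apply _ MeasurableSet.univ,
    Measure.restrict_univ]

theorem isFiniteMeasure_energyDistribution (hA : IsSelfAdjoint A) (hρ : IsState ρ) :
    IsFiniteMeasure (energyDistribution A ρ) :=
  ⟨by rw [energyDistribution_univ hA hρ.isPositive]; exact hρ.trace_ne_top.lt_top⟩

/-- If `F_A⁺ < c` somewhere, `{c ≤ F_A⁺}` is the intersection of the rays `[q, ∞)` over rational `q`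
with `F_A⁺(q) < c`, and continuity from above applies. Otherwise it is all of `ℝ`, of mass `τ(ρ) = ∫
Dν_ρ dμ`. -/
theorem lintegral_sq_sub_le [SigmaFinite μ] (hA : IsSelfAdjoint A) (hρ : IsState ρ) (c : ℝ≥0∞) :
    ∫⁻ x, (density ρ x ^ (1 / 2 : ℝ) - (‖ρ‖ₑ * c) ^ (1 / 2 : ℝ)) ^ 2 ∂μ ≤
      energyDistribution A ρ {l | c ≤ Function.rightLim (spectralDensity A) l} := by
  have hfin := isFiniteMeasure_energyDistribution hA hρ
  have hF := spectralDensity_mono A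
  by_cases hU : ∃ l, Function.rightLim (spectralDensity A) l < c
  · obtain ⟨l₀, hl₀⟩ := hU
    -- Right continuity of `F_A⁺` makes rational endpoints suffice.
    have hopen : ∀ l, Function.rightLim (spectralDensity A) l < c →
        ∃ q : ℚ, l < q ∧ Function.rightLim (spectralDensity A) q < c := by
      intro l hl
      have h1 := (hF.tendsto_rightLim l).eventually_lt_const hl
      obtain ⟨u, hu, hlu⟩ := (h1.and self_mem_nhdsWithin).exists
      obtain ⟨q, hq1, hq2⟩ := exists_rat_btwn (show l < u from hlu)
      exact ⟨q, hq1, (hF.rightLim_le hq2).trans_lt hu⟩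
    have hset : {l | c ≤ Function.rightLim (spectralDensity A) l} =
        ⋂ q : {q : ℚ // Function.rightLim (spectralDensity A) q < c}, Set.Ici ((q : ℚ) : ℝ) := by
      ext l
      simp only [Set.mem_ofPred_eq, Set.mem_iInter, Set.mem_Ici]
      constructor
      · intro h q
        by_contra! hlt
        exact absurd (h.trans (hF.rightLim hlt.le)) (not_le.mpr q.2)
      · intro h
        by_contra! hlt
        obtain ⟨q, hq1, hq2⟩ := hopen l hlt
        exact absurd (h ⟨q, hq2⟩) (not_le.mpr hq1)
    obtain ⟨q₀, -, hq₀⟩ := hopen l₀ hl₀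
    rw [hset, Directed.measure_iInter (fun _ => measurableSet_Ici.nullMeasurableSet)
      (directed_of_isDirected_le fun a b hab => Set.Ici_subset_Ici.mpr (by exact_mod_cast hab))
      ⟨⟨q₀, hq₀⟩, measure_ne_top _ _⟩]
    exact le_iInf fun q => lintegral_sq_sub_le_of_spectralDensity_le hA hρ
      ((hF.le_rightLim le_rfl).trans q.2.le)
  · push Not at hU
    have hset : {l | c ≤ Function.rightLim (spectralDensity A) l} = Set.univ :=
      Set.eq_univ_of_forall hU
    rw [hset, energyDistribution_univ hA hρ.isPositive, ← lintegral_density hρ.isPositive]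
    refine lintegral_mono fun x => ?_
    calc _ ≤ (density ρ x ^ (1 / 2 : ℝ)) ^ 2 := by gcongr; exact tsub_le_self
      _ = density ρ x := by rw [← ENNReal.rpow_two, ← ENNReal.rpow_mul]; simp

end

/-! ### Integration over exponential levels and removal of the truncation -/

section Integrals

theorem sq_mul_log_le_integral {a b : ℝ} (ha : 0 < a) (hb : 0 < b) {M : ℝ}
    (hM : -M ≤ 2 * Real.log (a / b)) :
    a ^ 2 * (2 * Real.log (a / b) + M - 3) ≤
      ∫ s in (-M)..(2 * Real.log (a / b)), (a - b * Real.exp (s / 2)) ^ 2 := by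
  have hd : ∀ s ∈ Set.uIcc (-M) (2 * Real.log (a / b)),
      HasDerivAt (fun s => a ^ 2 * s - 4 * a * b * Real.exp (s / 2) + b ^ 2 * Real.exp (s / 2) ^ 2)
        ((a - b * Real.exp (s / 2)) ^ 2) s := by
    intro s _
    have he : HasDerivAt (fun s : ℝ => Real.exp (s / 2)) (Real.exp (s / 2) * (1 / 2)) s :=
      ((hasDerivAt_id s).div_const 2).exp
    have h := (((hasDerivAt_id s).const_mul (a ^ 2)).sub (he.const_mul (4 * a * b))).add
      ((he.pow 2).const_mul (b ^ 2))
    refine h.congr_deriv ?_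
    push_cast
    ring
  have hint : IntervalIntegrable (fun s => (a - b * Real.exp (s / 2)) ^ 2) volume (-M)
      (2 * Real.log (a / b)) := (by fun_prop : Continuous _).intervalIntegrable _ _
  rw [intervalIntegral.integral_eq_sub_of_hasDerivAt hd hint]
  have e1 : Real.exp (2 * Real.log (a / b) / 2) = a / b := by
    rw [mul_div_cancel_left₀ _ two_ne_zero, Real.exp_log (by positivity)]
  have e2 : b * Real.exp (-M / 2) ≤ a := by
    have : Real.exp (-M / 2) ≤ a / b := by
      rw [← e1]; exact Real.exp_le_exp.mpr (by linarith)
    rwa [le_div_iff₀' hb] at this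
  rw [e1]
  set E := Real.exp (-M / 2)
  have hE : 0 < E := Real.exp_pos _
  have e3 : 4 * a * b * (a / b) = 4 * a ^ 2 := by field_simp
  have e4 : b ^ 2 * (a / b) ^ 2 = a ^ 2 := by field_simp
  rw [e3, e4]
  -- The upper endpoint contributes `-4a² + a² = -3a²`, the lower one `4abE - b²E²`, which is
  -- nonnegative because `bE ≤ a`.
  nlinarith [mul_le_mul_of_nonneg_left e2 (mul_pos hb hE).le, mul_pos ha (mul_pos hb hE)]

theorem ofReal_sq_rpow_half {a : ℝ} (ha : 0 ≤ a) :
    ENNReal.ofReal (a ^ 2) ^ (1 / 2 : ℝ) = ENNReal.ofReal a := by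
  rw [ENNReal.ofReal_pow ha, ← ENNReal.rpow_two, ← ENNReal.rpow_mul]
  simp

theorem exists_eq_ofReal_sq {x : ℝ≥0∞} (h0 : x ≠ 0) (ht : x ≠ ∞) :
    ∃ a : ℝ, 0 < a ∧ x = ENNReal.ofReal (a ^ 2) := by
  refine ⟨√x.toReal, Real.sqrt_pos.mpr (ENNReal.toReal_pos h0 ht), ?_⟩
  rw [Real.sq_sqrt ENNReal.toReal_nonneg, ENNReal.ofReal_toReal ht]

theorem mul_log_toENNReal_le_lintegral {r K : ℝ≥0∞} (hr : r ≠ ∞) (hK0 : K ≠ 0) (hK : K ≠ ∞)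
    (M : ℝ) :
    r * (ENNReal.log (r / K) + ((M - 3 : ℝ) : EReal)).toENNReal ≤
      ∫⁻ s in Set.Ioi (-M),
        (r ^ (1 / 2 : ℝ) - (K * ENNReal.ofReal (Real.exp s)) ^ (1 / 2 : ℝ)) ^ 2 := by
  rcases eq_or_ne r 0 with rfl | hr0
  · simp
  obtain ⟨a, ha, rfl⟩ := exists_eq_ofReal_sq hr0 hr
  obtain ⟨b, hb, rfl⟩ := exists_eq_ofReal_sq hK0 hK
  have hlog : ENNReal.log (ENNReal.ofReal (a ^ 2) / ENNReal.ofReal (b ^ 2)) =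
      ((2 * Real.log (a / b) : ℝ) : EReal) := by
    rw [← ENNReal.ofReal_div_of_pos (by positivity), ENNReal.log_ofReal_of_pos (by positivity),
      ← div_pow, Real.log_pow]
    norm_num
  have hexp : ∀ s : ℝ, (ENNReal.ofReal (b ^ 2) * ENNReal.ofReal (Real.exp s)) ^ (1 / 2 : ℝ) =
      ENNReal.ofReal (b * Real.exp (s / 2)) := by
    intro s
    have h : b ^ 2 * Real.exp s = (b * Real.exp (s / 2)) ^ 2 := by
      rw [mul_pow, ← Real.exp_nat_mul]
      congr 2
      push_cast
      ring
    rw [← ENNReal.ofReal_mul (by positivity), h, ofReal_sq_rpow_half (by positivity)]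
  rw [hlog, ← EReal.coe_add, EReal.real_coe_toENNReal, ← ENNReal.ofReal_mul (by positivity),
    ofReal_sq_rpow_half ha.le]
  simp_rw [hexp]
  -- In the first case the positive part on the left vanishes. In the second, `2 log (a / b)` is
  -- where the truncated difference reaches 0.
  rcases lt_or_ge (2 * Real.log (a / b)) (-M) with hM | hM
  · rw [ENNReal.ofReal_of_nonpos]
    · exact zero_le
    · exact mul_nonpos_of_nonneg_of_nonpos (by positivity) (by linarith)
  calc _ ≤ ENNReal.ofReal (∫ s in (-M)..(2 * Real.log (a / b)), (a - b * Real.exp (s / 2)) ^ 2) :=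
        ENNReal.ofReal_le_ofReal (by
          rw [← add_sub_assoc]; exact sq_mul_log_le_integral ha hb hM)
    _ = ∫⁻ s in Set.Ioc (-M) (2 * Real.log (a / b)),
          ENNReal.ofReal ((a - b * Real.exp (s / 2)) ^ 2) := by
        have hc : Continuous fun s : ℝ => (a - b * Real.exp (s / 2)) ^ 2 := by fun_prop
        rw [intervalIntegral.integral_of_le hM, ofReal_integral_eq_lintegral_ofReal
          ((intervalIntegrable_iff_integrableOn_Ioc_of_le hM).mp (hc.intervalIntegrable _ _))
          (Filter.Eventually.of_forall fun s => sq_nonneg _)]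
    _ = ∫⁻ s in Set.Ioc (-M) (2 * Real.log (a / b)),
          (ENNReal.ofReal a - ENNReal.ofReal (b * Real.exp (s / 2))) ^ 2 := by
        refine setLIntegral_congr_fun measurableSet_Ioc fun s hs => ?_
        have h1 : b * Real.exp (s / 2) ≤ a := by
          rw [← le_div_iff₀' hb, ← Real.le_log_iff_exp_le (by positivity)]
          linarith [hs.2]
        rw [← ENNReal.ofReal_sub _ (by positivity), ENNReal.ofReal_pow (by linarith)]
    _ ≤ _ := lintegral_mono_set Set.Ioc_subset_Ioi_self

theorem volume_exp_le_le (c : ℝ≥0∞) (M : ℝ) :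
    volume.restrict (Set.Ioi (-M)) {s : ℝ | ENNReal.ofReal (Real.exp s) ≤ c} ≤
      (ENNReal.log c + ((M : ℝ) : EReal)).toENNReal := by
  rw [Measure.restrict_apply (measurableSet_le (by fun_prop) measurable_const)]
  rcases eq_or_ne c ∞ with rfl | hc
  · simp
  rcases eq_or_ne c 0 with rfl | hc0
  · simp [not_le.mpr (Real.exp_pos _)]
  have hpos := ENNReal.toReal_pos hc0 hc
  calc _ ≤ volume (Set.Ioc (-M) (Real.log c.toReal)) := by
        refine measure_mono fun s hs => ⟨hs.2, ?_⟩
        rw [Real.le_log_iff_exp_le hpos]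
        exact (ENNReal.ofReal_le_iff_le_toReal hc).mp hs.1
    _ = _ := by
        rw [Real.volume_Ioc, ENNReal.log_pos_real hc0 hc, ← EReal.coe_add,
          EReal.real_coe_toENNReal, sub_neg_eq_add]

/-- Layer-cake argument: by Tonelli, each `l` contributes the length of `(-M, ln F(l)]`. -/
theorem lintegral_measure_exp_le_le {Y : Type*} [MeasurableSpace Y] (m : Measure Y)
    [IsFiniteMeasure m] {F : Y → ℝ≥0∞} (hF : Measurable F) (M : ℝ) :
    ∫⁻ s in Set.Ioi (-M), m {l | ENNReal.ofReal (Real.exp s) ≤ F l} ≤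
      ∫⁻ l, (ENNReal.log (F l) + ((M : ℝ) : EReal)).toENNReal ∂m := by
  have hS : MeasurableSet {p : ℝ × Y | ENNReal.ofReal (Real.exp p.1) ≤ F p.2} :=
    measurableSet_le (by fun_prop) (by fun_prop)
  calc _ = ((volume.restrict (Set.Ioi (-M))).prod m)
        {p : ℝ × Y | ENNReal.ofReal (Real.exp p.1) ≤ F p.2} := (Measure.prod_apply hS).symm
    _ = ∫⁻ l, volume.restrict (Set.Ioi (-M)) {s : ℝ | ENNReal.ofReal (Real.exp s) ≤ F l} ∂m :=
        Measure.prod_apply_symm hS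
    _ ≤ _ := lintegral_mono fun l => volume_exp_le_le (F l) M

theorem toENNReal_add_le (f : EReal) (M : ℕ) :
    f.toENNReal + M ≤ (f + ((M - 3 : ℝ) : EReal)).toENNReal + 3 + (-f).toENNReal := by
  induction f with
  | bot => simp
  | top => rw [EReal.top_add_coe]; simp
  | coe x =>
    rw [← EReal.coe_add, ← EReal.coe_neg]
    simp only [EReal.real_coe_toENNReal]
    rw [← ENNReal.ofReal_natCast M, ← ENNReal.ofReal_ofNat 3]
    have hM : (0 : ℝ) ≤ M := M.cast_nonneg
    rcases le_total 0 x with hx | hx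
    · rw [ENNReal.ofReal_of_nonpos (neg_nonpos.mpr hx), add_zero, ← ENNReal.ofReal_add hx hM,
        show x + M = x + (M - 3) + 3 by ring]
      exact ENNReal.ofReal_add_le
    · rw [ENNReal.ofReal_of_nonpos hx, zero_add]
      calc ENNReal.ofReal M = ENNReal.ofReal (x + (M - 3) + 3 + -x) := by congr 1; ring
        _ ≤ _ := ENNReal.ofReal_add_le.trans (by gcongr; exact ENNReal.ofReal_add_le)

theorem toENNReal_add_natCast_add (g : EReal) (M : ℕ) :
    (g + ((M : ℝ) : EReal)).toENNReal + min (-g).toENNReal M = g.toENNReal + M := by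
  induction g with
  | bot => simp
  | top => rw [EReal.top_add_coe]; simp
  | coe x =>
    rw [← EReal.coe_add, ← EReal.coe_neg]
    simp only [EReal.real_coe_toENNReal]
    rw [← ENNReal.ofReal_natCast M]
    have hM : (0 : ℝ) ≤ M := M.cast_nonneg
    rcases le_total 0 x with hx | hx
    · rw [ENNReal.ofReal_of_nonpos (neg_nonpos.mpr hx), min_eq_left zero_le, add_zero,
        ENNReal.ofReal_add hx hM]
    · rw [ENNReal.ofReal_of_nonpos hx, zero_add]
      rcases le_total (-x) M with h | h
      · rw [min_eq_left (ENNReal.ofReal_le_ofReal h), ← ENNReal.ofReal_add (by linarith)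
          (by linarith)]
        congr 1
        ring
      · rw [min_eq_right (ENNReal.ofReal_le_ofReal h), ENNReal.ofReal_of_nonpos (by linarith),
          zero_add]

theorem iSup_lintegral_min_natCast {Y : Type*} [MeasurableSpace Y] (m : Measure Y) {h : Y → ℝ≥0∞}
    (hh : Measurable h) : ⨆ M : ℕ, ∫⁻ y, min (h y) M ∂m = ∫⁻ y, h y ∂m := by
  rw [← lintegral_iSup (fun M => hh.min measurable_const)
    fun M N hMN y => min_le_min_left _ (by exact_mod_cast hMN)]
  refine lintegral_congr fun y => ?_
  change ⨆ M : ℕ, h y ⊓ (M : ℝ≥0∞) = h y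
  rw [← inf_iSup_eq, ENNReal.iSup_natCast, inf_top_eq]

/-- This is `∫ f dν ≤ ∫ g dm + 3 ν(Y)` with negative parts moved across, so that it makes sense in
`[0, ∞]`. Adding `M ν(Y)` to both sides absorbs the shifts; it is finite, hence cancels. The
truncated negative part of `g` grows to the full one as `M → ∞`. -/
theorem lintegral_pos_add_neg_le {Y Z : Type*} [MeasurableSpace Y] [MeasurableSpace Z]
    {ν : Measure Y} {m : Measure Z} [IsFiniteMeasure ν] (huniv : m Set.univ ≤ ν Set.univ)
    {f : Y → EReal} {g : Z → EReal} (hf : Measurable f) (hg : Measurable g)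
    (h : ∀ M : ℕ, ∫⁻ y, (f y + ((M - 3 : ℝ) : EReal)).toENNReal ∂ν ≤
      ∫⁻ z, (g z + ((M : ℝ) : EReal)).toENNReal ∂m) :
    ∫⁻ y, (f y).toENNReal ∂ν + ∫⁻ z, (-g z).toENNReal ∂m ≤
      3 * ν Set.univ + ∫⁻ y, (-f y).toENNReal ∂ν + ∫⁻ z, (g z).toENNReal ∂m := by
  have hfm := hf.ereal_toENNReal
  have hgm := hg.ereal_toENNReal
  have hfn : Measurable fun y => (-f y).toENNReal := hf.neg.ereal_toENNReal
  have hgn : Measurable fun z => (-g z).toENNReal := hg.neg.ereal_toENNReal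
  rw [← iSup_lintegral_min_natCast m hgn, ENNReal.add_iSup]
  refine iSup_le fun M => ?_
  have hM : (M : ℝ≥0∞) * ν Set.univ ≠ ∞ :=
    ENNReal.mul_ne_top (ENNReal.natCast_ne_top M) (measure_ne_top _ _)
  have h1 : ∫⁻ y, (f y).toENNReal ∂ν + M * ν Set.univ ≤
      ∫⁻ y, (f y + ((M - 3 : ℝ) : EReal)).toENNReal ∂ν + 3 * ν Set.univ +
        ∫⁻ y, (-f y).toENNReal ∂ν := by
    rw [← lintegral_const, ← lintegral_const, ← lintegral_add_left hfm,
      ← lintegral_add_right _ measurable_const, ← lintegral_add_right _ hfn]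
    exact lintegral_mono fun y => toENNReal_add_le (f y) M
  have h2 : ∫⁻ z, (g z + ((M : ℝ) : EReal)).toENNReal ∂m + ∫⁻ z, min (-g z).toENNReal M ∂m ≤
      ∫⁻ z, (g z).toENNReal ∂m + M * ν Set.univ := by
    rw [← lintegral_add_right _ (hgn.min measurable_const)]
    simp_rw [toENNReal_add_natCast_add]
    rw [lintegral_add_left hgm, lintegral_const]
    gcongr
  refine (ENNReal.add_le_add_iff_right hM).mp ?_
  calc _ = (∫⁻ y, (f y).toENNReal ∂ν + M * ν Set.univ) + ∫⁻ z, min (-g z).toENNReal M ∂m := by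
        ring
    _ ≤ (∫⁻ z, (g z + ((M : ℝ) : EReal)).toENNReal ∂m + 3 * ν Set.univ +
        ∫⁻ y, (-f y).toENNReal ∂ν) + ∫⁻ z, min (-g z).toENNReal M ∂m := by
        refine add_le_add_left (h1.trans ?_) _
        gcongr
        exact h M
    _ = 3 * ν Set.univ + ∫⁻ y, (-f y).toENNReal ∂ν +
        (∫⁻ z, (g z + ((M : ℝ) : EReal)).toENNReal ∂m + ∫⁻ z, min (-g z).toENNReal M ∂m) := by
        ring
    _ ≤ _ := by
        rw [add_assoc (3 * ν Set.univ + _)]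
        gcongr

theorem lintegral_toENNReal_ne_top {Y : Type*} [MeasurableSpace Y] {ν : Measure Y}
    [IsFiniteMeasure ν] {f : Y → EReal}
    (h : ∫⁻ y, (f y + ((-3 : ℝ) : EReal)).toENNReal ∂ν ≠ ∞) :
    ∫⁻ y, (f y).toENNReal ∂ν ≠ ∞ := by
  refine ne_top_of_le_ne_top (b := ∫⁻ y, (f y + ((-3 : ℝ) : EReal)).toENNReal ∂ν +
    3 * ν Set.univ) (ENNReal.add_ne_top.mpr ⟨h, ENNReal.mul_ne_top (by simp) (measure_ne_top _ _)⟩) ?_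
  rw [← lintegral_const, ← lintegral_add_right _ measurable_const]
  refine lintegral_mono fun y => ?_
  have e : f y = (f y + ((-3 : ℝ) : EReal)) + ((3 : ℝ) : EReal) := by
    rw [add_assoc, ← EReal.coe_add]; simp
  calc (f y).toENNReal = ((f y + ((-3 : ℝ) : EReal)) + ((3 : ℝ) : EReal)).toENNReal := by rw [← e]
    _ ≤ _ := EReal.toENNReal_add_le.trans (by simp)

end Integrals

/-! ### The truncated entropy inequality -/

section Entropy

variable {X : Type*} [MeasurableSpace X] {μ : Measure X}
  {V : Type*} [NormedAddCommGroup V] [InnerProductSpace ℂ V] [CompleteSpace V]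
  {A : Lp V 2 μ →ₗ.[ℂ] Lp V 2 μ} {ρ : Lp V 2 μ →L[ℂ] Lp V 2 μ}

theorem isFiniteMeasure_densityMeasure (hρ : IsState ρ) : IsFiniteMeasure (densityMeasure ρ) :=
  ⟨by rw [densityMeasure_univ hρ.isPositive]; exact hρ.trace_ne_top.lt_top⟩

theorem lintegral_log_density_le [SigmaFinite μ] (hA : IsSelfAdjoint A) (hρ : IsState ρ) (M : ℝ) :
    ∫⁻ x, (ENNReal.log (density ρ x / ‖ρ‖ₑ) + ((M - 3 : ℝ) : EReal)).toENNReal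
        ∂(densityMeasure ρ) ≤
      ∫⁻ l, (logSpectralDensity A l + ((M : ℝ) : EReal)).toENNReal ∂(energyDistribution A ρ) := by
  have := isFiniteMeasure_energyDistribution hA hρ
  have := isFiniteMeasure_densityMeasure hρ
  -- The pointwise bound needs `‖ρ‖ ≠ 0`; for `ρ = 0` the measure `ν_ρ` vanishes.
  rcases eq_or_ne ρ 0 with rfl | h0
  · have : densityMeasure (0 : Lp V 2 μ →L[ℂ] Lp V 2 μ) = 0 := by
      rw [← Measure.measure_univ_eq_zero, densityMeasure_univ hρ.isPositive]
      simp [trace]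
    simp [this]
  have hm := measurable_density ρ
  calc _ = ∫⁻ x, density ρ x *
          (ENNReal.log (density ρ x / ‖ρ‖ₑ) + ((M - 3 : ℝ) : EReal)).toENNReal ∂μ := by
        conv_lhs => rw [← withDensity_density]
        exact lintegral_withDensity_eq_lintegral_mul _ hm
          ((hm.div_const _).ennreal_log.add_const _).ereal_toENNReal
    _ ≤ ∫⁻ x, (∫⁻ s in Set.Ioi (-M), (density ρ x ^ (1 / 2 : ℝ) -
          (‖ρ‖ₑ * ENNReal.ofReal (Real.exp s)) ^ (1 / 2 : ℝ)) ^ 2) ∂μ := by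
        refine lintegral_mono_ae ?_
        filter_upwards [Measure.rnDeriv_lt_top (densityMeasure ρ) μ] with x hx
        exact mul_log_toENNReal_le_lintegral hx.ne (by simpa using h0) (by simp) M
    _ = ∫⁻ s in Set.Ioi (-M), (∫⁻ x, (density ρ x ^ (1 / 2 : ℝ) -
          (‖ρ‖ₑ * ENNReal.ofReal (Real.exp s)) ^ (1 / 2 : ℝ)) ^ 2 ∂μ) := by
        refine lintegral_lintegral_swap (Measurable.aemeasurable ?_)
        simp only [Function.uncurry_def]
        fun_prop
    _ ≤ ∫⁻ s in Set.Ioi (-M), energyDistribution A ρ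
          {l | ENNReal.ofReal (Real.exp s) ≤ Function.rightLim (spectralDensity A) l} :=
        lintegral_mono fun s => lintegral_sq_sub_le hA hρ _
    _ ≤ _ := lintegral_measure_exp_le_le _ (spectralDensity_mono A).rightLim.measurable M

end Entropy

end EntropyBound

end

open EntropyBound in
theorem mainTheorem3 {X : Type*} [MeasurableSpace X] (μ : Measure X) [SigmaFinite μ]
    {V : Type*} [NormedAddCommGroup V] [InnerProductSpace ℂ V] [CompleteSpace V]
    [TopologicalSpace.SeparableSpace V]
    (A : Lp V 2 μ →ₗ.[ℂ] Lp V 2 μ) (hA : IsSelfAdjoint A)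
    (ρ : Lp V 2 μ →L[ℂ] Lp V 2 μ) (hρ : IsState ρ)
    (hE : posEnergy (logSpectralDensity A) A ρ ≠ ∞) :
    -- the integral in the spatial entropy has a finite negative part
    (∫⁻ x, (-entropyIntegrand ρ x).toENNReal ∂(densityMeasure ρ)) ≠ ∞ ∧
    -- the entropies lie in `[-∞, ∞)` and `(-∞, ∞]`
    spectralEntropy A ρ ≠ ⊤ ∧ spatialEntropy ρ ≠ ⊥ ∧
    -- the entropy bound, the sum being meaningful unless the two terms are `-∞` and `+∞`
    (spectralEntropy A ρ = ⊥ → spatialEntropy ρ = ⊤) ∧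
    (spectralEntropy A ρ ≠ ⊥ → 0 ≤ spectralEntropy A ρ + spatialEntropy ρ) := by
  have hfin := isFiniteMeasure_densityMeasure hρ
  have hgm : Measurable (logSpectralDensity A) :=
    (spectralDensity_mono A).rightLim.measurable.ennreal_log
  have hfm : Measurable fun x => ENNReal.log (density ρ x / ‖ρ‖ₑ) :=
    ((measurable_density ρ).div_const _).ennreal_log
  have hτ := hρ.trace_ne_top
  have huniv := densityMeasure_univ hρ.isPositive
  -- The case `M = 0` bounds `∫ (ln(Dν_ρ/‖ρ‖) - 3)₊ dν_ρ` by the finite positive energy, giving the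
  -- first claim.
  have h0 := lintegral_log_density_le hA hρ 0
  have key := lintegral_pos_add_neg_le
    ((energyDistribution_univ hA hρ.isPositive).trans huniv.symm).le hfm hgm
    fun M => lintegral_log_density_le hA hρ M
  simp only [zero_sub, EReal.coe_zero, add_zero] at h0
  have ha := lintegral_toENNReal_ne_top (ne_top_of_le_ne_top hE h0)
  rw [huniv] at key
  simp only [spectralEntropy, energy, spatialEntropy, extIntegral, entropyIntegrand, neg_neg]
  rw [posEnergy] at hE
  generalize ∫⁻ x, (ENNReal.log (density ρ x / ‖ρ‖ₑ)).toENNReal ∂(densityMeasure ρ) = a at *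
  generalize ∫⁻ x, (-ENNReal.log (density ρ x / ‖ρ‖ₑ)).toENNReal ∂(densityMeasure ρ) = b at *
  generalize ∫⁻ l, (logSpectralDensity A l).toENNReal ∂(energyDistribution A ρ) = c at *
  generalize ∫⁻ l, (-logSpectralDensity A l).toENNReal ∂(energyDistribution A ρ) = d at *
  generalize trace ρ = t at *
  lift a to NNReal using ha
  lift c to NNReal using hE
  lift t to NNReal using hτ
  have hcoe : ∀ x : NNReal, ((x : ℝ≥0∞) : EReal) = ((x : ℝ) : EReal) := fun _ => rfl
  have h3 : (3 : EReal) * ((t : ℝ≥0∞) : EReal) = ((3 * t : ℝ) : EReal) := by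
    rw [hcoe, EReal.coe_mul]; rfl
  have htop : ((∞ : ℝ≥0∞) : EReal) - ((a : ℝ) : EReal) + ((3 * t : ℝ) : EReal) = ⊤ := by
    rw [EReal.coe_ennreal_top, EReal.top_sub_coe, EReal.top_add_coe]
  rw [h3, hcoe, hcoe]
  refine ⟨ENNReal.coe_ne_top, ?_⟩
  -- With `a`, `c`, `t` finite, `key` reads `a + d ≤ 3t + b + c`: an infinite `d` forces `b = ∞`,
  -- and otherwise the bound is real arithmetic or has `S_μ(ρ) = ∞`.
  induction d with
  | top =>
    have hb : b = ∞ := by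
      by_contra hb
      rw [add_top, top_le_iff] at key
      exact ENNReal.add_ne_top.mpr ⟨ENNReal.add_ne_top.mpr
        ⟨ENNReal.mul_ne_top (by simp) ENNReal.coe_ne_top, hb⟩, ENNReal.coe_ne_top⟩ key
    have hbot : ((c : ℝ) : EReal) - ⊤ = ⊥ := rfl
    rw [hb, htop, EReal.coe_ennreal_top, hbot]
    simp
  | coe d =>
    rw [hcoe, ← EReal.coe_sub]
    induction b with
    | top =>
      rw [htop, EReal.coe_add_top]
      exact ⟨EReal.coe_ne_top _, top_ne_bot, fun _ => rfl, fun _ => le_top⟩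
    | coe b =>
      have key' : (a : ℝ) + d ≤ 3 * t + b + c := by exact_mod_cast key
      rw [hcoe, ← EReal.coe_sub, ← EReal.coe_add, ← EReal.coe_add]
      refine ⟨EReal.coe_ne_top _, EReal.coe_ne_bot _, fun h => absurd h (EReal.coe_ne_bot _),
        fun _ => ?_⟩
      rw [← EReal.coe_zero, EReal.coe_le_coe_iff]
      linarith
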